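/- **Corollary (Sklyanin's formula).** Let $n\in\mathbb N$, let $g\in\mathbb R$ with $g\neq 0$, let $\mathcal C=\{q\in\mathbb R^n : q_1>\dots>q_n\}$, and let $T^*\mathcal C=\{(q,p) : q\in\mathcal C,\ p\in\mathbb R^n\}$ be the phase space of the rational Calogero–Moser system, with symplectic form $\omega=\sum_j dq_j\wedge dp_j$ and Poisson bracket $$\{F,G\}=\sum_{j=1}^n\Big(\frac{\partial F}{\partial q_j}\frac{\partial G}{\partial p_j}-\frac{\partial F}{\partial p_j}\frac{\partial G}{\partial q_j}\Big)$$ (for complex-valued functions). Put $Q=\operatorname{diag}(q_1,\dots,q_n)$, $v=(1,\dots,1)^\dagger$, $$L_{jk}=p_j\delta_{jk}+\mathrm i g\,\frac{1-\delta_{jk}}{q_j-q_k},\qquad A(z)=\det(z\mathbf 1_n-L),\qquad C(z)=\operatorname{tr}\big(Q\operatorname{adj}(z\mathbf 1_n-L)\,vv^\dagger\big).$$ Let $\lambda_1\ge\dots\ge\lambda_n$ be the eigenvalues of the Hermitian matrix $L$, in decreasing order. Then on all of $T^*\mathcal C$: 1. $\lambda_1>\dots>\lambda_n$, so $A'(\lambda_k)\ne0$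 and the functions $$\theta_k=\frac{C(\lambda_k)}{A'(\lambda_k)},\qquad k=1,\dots,n,$$ are well defined; all $\lambda_k$ and $\theta_k$ are smooth. 2. The $\theta_k$ are canonically conjugate to the $\lambda_k$: for all $j,k$, $$\{\theta_j,\theta_k\}=0,\qquad \{\theta_j,\lambda_k\}=\delta_{jk},\qquad \{\lambda_j,\lambda_k\}=0.$$ 3. Let $\mu=\mathrm i g(vv^\dagger-\mathbf 1_n)$. For every $(q,p)\in T^*\mathcal C$ there is exactly one pair $(\phi,\nu)\in\mathbb R^n\times\mathcal C$ for which some unitary $U$ with $U\mu U^\dagger=\mu$ satisfies $$(UQU^\dagger)_{jk}=\phi_j\delta_{jk}-\mathrm i g\,\frac{1-\delta_{jk}}{\nu_j-\nu_k},\qquad (ULU^\dagger)_{jk}=\nu_j\delta_{jk},$$ and $\nu=(\lambda_1,\dots,\lambda_n)$ in this pair. The functions $\phi_1,\dots,\phi_n$ on $T^*\mathcal C$ so defined (the action-angle, or dual, angle variables) are smooth, satisfy $\{\phi_j,\phi_k\}=0$ and $\{\phi_j,\lambda_k\}=\delta_{jk}$, and $$\theta_k=\phi_k+\mathrm i g\sum_{\ell\neq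 k}\frac{1}{\lambda_k-\lambda_\ell},\qquad k=1,\dots,n.$$ -/

import Mathlib

open scoped ContDiff Matrix

namespace CalogeroMoser

/-- The configuration space: `q` with `q_1 > ⋯ > q_n`. -/
def configSpace (n : ℕ) : Set (Fin n → ℝ) := {q | StrictAnti q}

/-- The phase space: pairs `(q, p)` with `q` in the configuration space and `p` arbitrary. It is an
open subset of `ℝⁿ × ℝⁿ`. -/
def phaseSpace (n : ℕ) : Set ((Fin n → ℝ) × (Fin n → ℝ)) := {x | x.1 ∈ configSpace n}

/-- The Poisson bracket of the symplectic form `∑ dq_j ∧ dp_j`, for complex valued functions: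
`{F, G} = ∑_j (∂F/∂q_j ∂G/∂p_j - ∂F/∂p_j ∂G/∂q_j)`. -/
noncomputable def poisson {n : ℕ} (F G : (Fin n → ℝ) × (Fin n → ℝ) → ℂ)
    (x : (Fin n → ℝ) × (Fin n → ℝ)) : ℂ :=
  ∑ j : Fin n,
    (fderiv ℝ F x (Pi.single j 1, 0) * fderiv ℝ G x (0, Pi.single j 1)
      - fderiv ℝ F x (0, Pi.single j 1) * fderiv ℝ G x (Pi.single j 1, 0))

/-- The matrix `Q = diag(q_1, …, q_n)`. -/
def posMatrix {n : ℕ} (x : (Fin n → ℝ) × (Fin n → ℝ)) : Matrix (Fin n) (Fin n) ℂ :=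
  Matrix.diagonal fun j => (x.1 j : ℂ)

/-- The Lax matrix `L_{jk} = p_j δ_{jk} + i g (1 - δ_{jk}) / (q_j - q_k)`. -/
noncomputable def lax {n : ℕ} (g : ℝ) (x : (Fin n → ℝ) × (Fin n → ℝ)) :
    Matrix (Fin n) (Fin n) ℂ :=
  Matrix.of fun j k =>
    if j = k then (x.2 j : ℂ) else Complex.I * (g : ℂ) / ((x.1 j : ℂ) - (x.1 k : ℂ))

theorem lax_isHermitian {n : ℕ} (g : ℝ) (x : (Fin n → ℝ) × (Fin n → ℝ)) :
    (lax g x).IsHermitian := by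
  ext j k
  by_cases h : j = k
  · subst h
    simp [lax]
  · have h' : ¬ k = j := fun e => h e.symm
    simp only [lax, Matrix.conjTranspose_apply, Matrix.of_apply, if_neg h, if_neg h',
      RCLike.star_def, map_div₀, map_mul, map_sub, Complex.conj_I, Complex.conj_ofReal]
    rw [← neg_sub (x.1 j : ℂ) (x.1 k : ℂ), neg_mul, neg_div_neg_eq]

/-- The eigenvalues `λ_1 ≥ ⋯ ≥ λ_n` of the Lax matrix, with multiplicity, in decreasing order. -/
noncomputable def eigenvalue {n : ℕ} (g : ℝ) (k : Fin n) (x : (Fin n → ℝ) × (Fin n → ℝ)) : ℝ :=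
  (lax_isHermitian g x).eigenvalues₀ (Fin.cast (Fintype.card_fin n).symm k)

/-- The matrix `v v†` with `v = (1, …, 1)`. -/
def onesMatrix (n : ℕ) : Matrix (Fin n) (Fin n) ℂ :=
  Matrix.vecMulVec (fun _ => 1) (star fun _ => 1)

/-- `A(z) = det(z 1 - L)`. -/
noncomputable def polyA {n : ℕ} (g : ℝ) (x : (Fin n → ℝ) × (Fin n → ℝ)) (z : ℂ) : ℂ :=
  (z • (1 : Matrix (Fin n) (Fin n) ℂ) - lax g x).det

/-- `C(z) = tr(Q adj(z 1 - L) v v†)`. -/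
noncomputable def polyC {n : ℕ} (g : ℝ) (x : (Fin n → ℝ) × (Fin n → ℝ)) (z : ℂ) : ℂ :=
  (posMatrix x * (z • (1 : Matrix (Fin n) (Fin n) ℂ) - lax g x).adjugate * onesMatrix n).trace

/-- `θ_k = C(λ_k) / A'(λ_k)`. -/
noncomputable def theta {n : ℕ} (g : ℝ) (k : Fin n) (x : (Fin n → ℝ) × (Fin n → ℝ)) : ℂ :=
  polyC g x (eigenvalue g k x : ℂ) / deriv (polyA g x) (eigenvalue g k x : ℂ)

/-- The value `μ = i g (v v† - 1)` of the momentum map. -/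
noncomputable def momentumValue (n : ℕ) (g : ℝ) : Matrix (Fin n) (Fin n) ℂ :=
  (Complex.I * (g : ℂ)) • (onesMatrix n - 1)

/-- The matrix `Q̃_{jk} = φ_j δ_{jk} - i g (1 - δ_{jk}) / (λ_j - λ_k)`. -/
noncomputable def dualPosMatrix {n : ℕ} (g : ℝ) (φ lam : Fin n → ℝ) :
    Matrix (Fin n) (Fin n) ℂ :=
  Matrix.of fun j k =>
    if j = k then (φ j : ℂ) else -(Complex.I * (g : ℂ) / ((lam j : ℂ) - (lam k : ℂ)))

/-- `(φ, λ)` are the action-angle (dual) coordinates of the phase space point `x = (q, p)`: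
`λ_1 > ⋯ > λ_n`, and some unitary matrix that stabilizes `μ` conjugates the pair `(Q, L)` to the
point `(Q̃(φ, λ), diag(λ))` of the gauge slice in which the second matrix is diagonal. -/
def IsActionAngle {n : ℕ} (g : ℝ) (x : (Fin n → ℝ) × (Fin n → ℝ)) (φ lam : Fin n → ℝ) : Prop :=
  lam ∈ configSpace n ∧
    ∃ U ∈ Matrix.unitaryGroup (Fin n) ℂ,
      U * momentumValue n g * Uᴴ = momentumValue n g ∧
      U * posMatrix x * Uᴴ = dualPosMatrix g φ lam ∧
      U * lax g x * Uᴴ = Matrix.diagonal fun j => (lam j : ℂ)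

end CalogeroMoser

namespace CalogeroMoser

/-! Everything rests on the constraint `[Q, L] = μ`. In a unitary basis diagonalizing `L`, with `w =
U v` and `Q₀ = U Q U†`, its entries read `Q₀_jk (λ_k - λ_j) = i g (w_j conj(w_k) - δ_jk)`. The
diagonal forces `|w_j| = 1`; the off-diagonal entries then force simple spectrum and determine `Q₀`
off the diagonal. Absorbing the phases of `w` into `U` gives the dual form `Q̃`
(`exists_rephasing`).

At a simple eigenvalue, `adj(λ_k - L)` is `A'(λ_k)` times the spectral projection, so `θ_k` is the
sum of the `k`-th column of `Q̃` (`IsActionAngle.theta_eq`). Hence `φ_k = Re θ_k`, which yields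
uniqueness and smoothness of the angles.

For the brackets, write `ω = tr(dQ ∧ dL)` and conjugate by the smooth frame `W = U†`. With `Z = U
dW` the differentials become `dQ̃ + [Z, Q̃]` and `dΛ + [Z, Λ]`. The differentiated constraint
removes the terms linear in `Z` (`trace_symplectic_identity`); the rest is `tr(μ [Z, Z'])`, which
vanishes because `W v = v` gives `Z v = 0`. So `ω = ∑ dφ_j ∧ dλ_j`, and the brackets follow by
inverting a symplectic Jacobian. Finally `θ - φ` depends on `λ` alone with symmetric Jacobian, so
`θ` may replace `φ`. -/

/-! ### The constraint and the passage to the dual gauge -/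

theorem onesMatrix_apply (n : ℕ) (j k : Fin n) : onesMatrix n j k = 1 := by
  simp [onesMatrix, Matrix.vecMulVec_apply]

theorem momentumValue_apply (n : ℕ) (g : ℝ) (j k : Fin n) :
    momentumValue n g j k = if j = k then 0 else Complex.I * g := by
  by_cases h : j = k <;> simp [momentumValue, onesMatrix_apply, h]

/-- The momentum map constraint `[Q, L] = μ`. -/
theorem commutator_posMatrix_lax {n : ℕ} {g : ℝ} {x : (Fin n → ℝ) × (Fin n → ℝ)}
    (hx : x ∈ phaseSpace n) :
    posMatrix x * lax g x - lax g x * posMatrix x = momentumValue n g := by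
  have hq : Function.Injective x.1 := StrictAnti.injective hx
  ext j k
  rw [Matrix.sub_apply, posMatrix, Matrix.diagonal_mul, Matrix.mul_diagonal, momentumValue_apply]
  by_cases h : j = k
  · subst h
    simp [mul_comm]
  · have h0 : (x.1 j : ℂ) - x.1 k ≠ 0 := by
      rw [sub_ne_zero]
      exact_mod_cast hq.ne h
    simp only [lax, Matrix.of_apply, if_neg h]
    field_simp

/-- The constraint satisfied by the dual pair `(Q̃, Λ)`. -/
theorem commutator_dualPosMatrix {n : ℕ} {g : ℝ} {φ lam : Fin n → ℝ} (hl : StrictAnti lam) :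
    dualPosMatrix g φ lam * Matrix.diagonal (fun j => (lam j : ℂ)) -
      Matrix.diagonal (fun j => (lam j : ℂ)) * dualPosMatrix g φ lam = momentumValue n g := by
  ext j k
  rw [Matrix.sub_apply, Matrix.diagonal_mul, Matrix.mul_diagonal, momentumValue_apply]
  by_cases h : j = k
  · subst h
    simp [mul_comm]
  · have h0 : (lam j : ℂ) - lam k ≠ 0 := by
      rw [sub_ne_zero]
      exact_mod_cast hl.injective.ne h
    simp only [dualPosMatrix, Matrix.of_apply, if_neg h]
    field_simp
    ring

/-- Every Hermitian Lax matrix is diagonalized by a unitary matrix, with decreasing eigenvalues. -/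
theorem exists_unitary_lax_diagonal {n : ℕ} (g : ℝ) (x : (Fin n → ℝ) × (Fin n → ℝ)) :
    ∃ U ∈ Matrix.unitaryGroup (Fin n) ℂ,
      U * lax g x * Uᴴ = Matrix.diagonal fun j => (eigenvalue g j x : ℂ) := by
  set hA := lax_isHermitian g x
  -- `eigenvalues` is indexed through an arbitrary equivalence of types of equal cardinality; `σ`
  -- undoes it and restores the decreasing order of `eigenvalues₀`.
  let σ : Fin n ≃ Fin n :=
    (finCongr (Fintype.card_fin n).symm).trans (Fintype.equivOfCardEq (Fintype.card_fin _))
  have hσ : ∀ k, hA.eigenvalues (σ k) = eigenvalue g k x := by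
    intro k
    simp only [Matrix.IsHermitian.eigenvalues, σ, Equiv.trans_apply, Equiv.symm_apply_apply]
    rfl
  let V : Matrix (Fin n) (Fin n) ℂ := hA.eigenvectorUnitary
  have hV : Vᴴ * lax g x * V = Matrix.diagonal (RCLike.ofReal ∘ hA.eigenvalues) := by
    have := hA.conjStarAlgAut_star_eigenvectorUnitary
    rwa [Unitary.conjStarAlgAut_star_apply] at this
  have hV2 : Vᴴ * V = 1 := Unitary.coe_star_mul_self hA.eigenvectorUnitary
  refine ⟨Vᴴ.submatrix σ id, ?_, ?_⟩
  · rw [Matrix.mem_unitaryGroup_iff, Matrix.star_eq_conjTranspose, Matrix.conjTranspose_submatrix,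
      Matrix.conjTranspose_conjTranspose]
    have : Vᴴ.submatrix σ id * V.submatrix id σ = (Vᴴ * V).submatrix σ σ := by
      ext i j
      simp [Matrix.mul_apply]
    rw [this, hV2, Matrix.submatrix_one_equiv]
  · have : Vᴴ.submatrix σ id * lax g x * (Vᴴ.submatrix σ id)ᴴ =
        (Vᴴ * lax g x * V).submatrix σ σ := by
      rw [Matrix.conjTranspose_submatrix, Matrix.conjTranspose_conjTranspose]
      ext i j
      simp [Matrix.mul_apply]
    rw [this, hV]
    ext i j
    by_cases h : i = j
    · subst h
      simp [hσ]
    · simp [h]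

theorem unitary_mul_conjTranspose {n : ℕ} {U : Matrix (Fin n) (Fin n) ℂ}
    (hU : U ∈ Matrix.unitaryGroup (Fin n) ℂ) : U * Uᴴ = 1 :=
  Matrix.mem_unitaryGroup_iff.mp hU

theorem unitary_conjTranspose_mul {n : ℕ} {U : Matrix (Fin n) (Fin n) ℂ}
    (hU : U ∈ Matrix.unitaryGroup (Fin n) ℂ) : Uᴴ * U = 1 :=
  Matrix.mem_unitaryGroup_iff'.mp hU

theorem unitary_conj_mul {n : ℕ} {U : Matrix (Fin n) (Fin n) ℂ}
    (hU : U ∈ Matrix.unitaryGroup (Fin n) ℂ) (A B : Matrix (Fin n) (Fin n) ℂ) :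
    U * (A * B) * Uᴴ = (U * A * Uᴴ) * (U * B * Uᴴ) := by
  calc U * (A * B) * Uᴴ = U * A * (1 : Matrix (Fin n) (Fin n) ℂ) * B * Uᴴ := by noncomm_ring
    _ = _ := by rw [← unitary_conjTranspose_mul hU]; noncomm_ring

/-- A unitary matrix that diagonalizes `L` can be rephased so that it fixes `(1, …, 1)`; it then
brings `Q` to its dual form, and the eigenvalues are distinct. -/
theorem exists_rephasing {n : ℕ} {g : ℝ} (hg : g ≠ 0) {x : (Fin n → ℝ) × (Fin n → ℝ)}
    (hx : x ∈ phaseSpace n) {lam : Fin n → ℝ} {U : Matrix (Fin n) (Fin n) ℂ}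
    (hU : U ∈ Matrix.unitaryGroup (Fin n) ℂ)
    (hL : U * lax g x * Uᴴ = Matrix.diagonal fun j => (lam j : ℂ)) :
    Function.Injective lam ∧ ∃ V ∈ Matrix.unitaryGroup (Fin n) ℂ, ∃ φ : Fin n → ℝ,
      V *ᵥ 1 = 1 ∧ V * posMatrix x * Vᴴ = dualPosMatrix g φ lam ∧
      V * lax g x * Vᴴ = Matrix.diagonal fun j => (lam j : ℂ) := by
  set w : Fin n → ℂ := U *ᵥ 1 with hw
  set Q0 := U * posMatrix x * Uᴴ with hQ0
  have hones : U * onesMatrix n * Uᴴ = Matrix.vecMulVec w (star w) := by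
    have h1 : (fun _ => 1 : Fin n → ℂ) = 1 := rfl
    rw [onesMatrix, h1, Matrix.mul_vecMulVec, Matrix.vecMulVec_mul, hw, Matrix.star_mulVec]
  have hcomm : Q0 * Matrix.diagonal (fun j => (lam j : ℂ)) -
      Matrix.diagonal (fun j => (lam j : ℂ)) * Q0 =
      (Complex.I * g : ℂ) • (Matrix.vecMulVec w (star w) - 1) := by
    rw [← hL, hQ0, ← unitary_conj_mul hU, ← unitary_conj_mul hU, ← Matrix.sub_mul,
      ← Matrix.mul_sub, commutator_posMatrix_lax hx, momentumValue, Matrix.mul_smul,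
      Matrix.smul_mul, Matrix.mul_sub, Matrix.sub_mul, hones, Matrix.mul_one,
      unitary_mul_conjTranspose hU]
  have hIg : (Complex.I * g : ℂ) ≠ 0 := by simp [hg]
  have hent : ∀ j k, Q0 j k * ((lam k : ℂ) - lam j) =
      Complex.I * g * (w j * star (w k) - if j = k then 1 else 0) := by
    intro j k
    have := congrFun (congrFun hcomm j) k
    rw [Matrix.sub_apply, Matrix.mul_diagonal, Matrix.diagonal_mul, Matrix.smul_apply,
      Matrix.sub_apply, Matrix.vecMulVec_apply, Matrix.one_apply, smul_eq_mul,
      Pi.star_apply] at this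
    rw [← this]
    ring
  -- On the diagonal the left side of `hent` vanishes, and `g ≠ 0`.
  have hw1 : ∀ j, w j * star (w j) = 1 := by
    intro j
    have := hent j j
    rw [sub_self, mul_zero, if_pos rfl, eq_comm, mul_eq_zero] at this
    exact sub_eq_zero.mp (this.resolve_left hIg)
  have hw0 : ∀ j, w j ≠ 0 := fun j h => by simpa [h] using hw1 j
  -- A repeated eigenvalue would make an off-diagonal left side of `hent` vanish, but no `w j` is
  -- zero.
  have hinj : Function.Injective lam := by
    intro j k hjk
    by_contra hne
    have := hent j k
    rw [hjk, sub_self, mul_zero, if_neg hne, sub_zero, eq_comm] at this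
    simp [hIg, hw0] at this
  -- Multiplying by the conjugate phases sends `w` to `(1, …, 1)`. It leaves the diagonal of the
  -- Hermitian matrix `Q0` unchanged, so the angles are these real entries.
  refine ⟨hinj, Matrix.diagonal (star w) * U, ?_, fun j => (Q0 j j).re, ?_, ?_, ?_⟩
  · refine mul_mem ?_ hU
    rw [Matrix.mem_unitaryGroup_iff, Matrix.star_eq_conjTranspose, Matrix.diagonal_conjTranspose,
      Matrix.diagonal_mul_diagonal, ← Matrix.diagonal_one]
    congr 1
    ext j
    simpa [mul_comm] using hw1 j
  · ext j
    rw [← Matrix.mulVec_mulVec, ← hw, Matrix.mulVec_diagonal, Pi.star_apply, mul_comm, hw1,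
      Pi.one_apply]
  · have hassoc : Matrix.diagonal (star w) * U * posMatrix x * (Matrix.diagonal (star w) * U)ᴴ =
        Matrix.diagonal (star w) * Q0 * Matrix.diagonal w := by
      rw [Matrix.conjTranspose_mul, Matrix.diagonal_conjTranspose, star_star, hQ0]
      noncomm_ring
    rw [hassoc]
    ext j k
    rw [Matrix.mul_diagonal, Matrix.diagonal_mul, Pi.star_apply]
    by_cases h : j = k
    · subst h
      have hH : Q0.IsHermitian := by
        rw [hQ0]
        refine Matrix.isHermitian_mul_mul_conjTranspose U ?_
        rw [posMatrix, Matrix.IsHermitian, Matrix.diagonal_conjTranspose]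
        congr 1
        ext i
        simp
      have hre : ((Q0 j j).re : ℂ) = Q0 j j := hH.coe_re_apply_self j
      rw [dualPosMatrix, Matrix.of_apply, if_pos rfl, hre]
      linear_combination Q0 j j * hw1 j
    · have h0 : (lam j : ℂ) - lam k ≠ 0 := by
        rw [sub_ne_zero]
        exact_mod_cast hinj.ne h
      have := hent j k
      rw [if_neg h] at this
      rw [dualPosMatrix, Matrix.of_apply, if_neg h, eq_neg_iff_add_eq_zero]
      field_simp
      linear_combination (-star (w j) * w k) * this -
        Complex.I * g * w k * star (w k) * hw1 j - Complex.I * g * hw1 k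
  · have hassoc : Matrix.diagonal (star w) * U * lax g x * (Matrix.diagonal (star w) * U)ᴴ =
        Matrix.diagonal (star w) * (U * lax g x * Uᴴ) * Matrix.diagonal w := by
      rw [Matrix.conjTranspose_mul, Matrix.diagonal_conjTranspose, star_star]
      noncomm_ring
    rw [hassoc, hL, Matrix.diagonal_mul_diagonal, Matrix.diagonal_mul_diagonal]
    congr 1
    ext j
    rw [Pi.star_apply]
    linear_combination (lam j : ℂ) * hw1 j

theorem eigenvalue_antitone {n : ℕ} (g : ℝ) (x : (Fin n → ℝ) × (Fin n → ℝ)) :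
    Antitone fun k : Fin n => eigenvalue g k x := fun _ _ h =>
  (lax_isHermitian g x).eigenvalues₀_antitone (Fin.le_def.mpr (Fin.le_def.mp h))

theorem eigenvalue_strictAnti {n : ℕ} {g : ℝ} (hg : g ≠ 0) {x : (Fin n → ℝ) × (Fin n → ℝ)}
    (hx : x ∈ phaseSpace n) : StrictAnti fun k : Fin n => eigenvalue g k x := by
  obtain ⟨U, hU, hL⟩ := exists_unitary_lax_diagonal g x
  exact (eigenvalue_antitone g x).strictAnti_of_injective (exists_rephasing hg hx hU hL).1

theorem unitary_conj_momentumValue {n : ℕ} (g : ℝ) {U : Matrix (Fin n) (Fin n) ℂ}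
    (hU : U ∈ Matrix.unitaryGroup (Fin n) ℂ) (h1 : U *ᵥ 1 = 1) :
    U * momentumValue n g * Uᴴ = momentumValue n g := by
  have hv : (fun _ => 1 : Fin n → ℂ) = 1 := rfl
  have hones : U * onesMatrix n * Uᴴ = onesMatrix n := by
    rw [onesMatrix, hv, Matrix.mul_vecMulVec, Matrix.vecMulVec_mul, ← Matrix.star_mulVec, h1]
  rw [momentumValue, Matrix.mul_smul, Matrix.smul_mul, Matrix.mul_sub, Matrix.sub_mul, hones,
    Matrix.mul_one, unitary_mul_conjTranspose hU]

/-- Fixing `v` itself, not only `μ`, removes the leftover global phase of the unitary; the smooth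
frame below relies on this normalization. -/
theorem exists_unitary_dual {n : ℕ} {g : ℝ} (hg : g ≠ 0) {x : (Fin n → ℝ) × (Fin n → ℝ)}
    (hx : x ∈ phaseSpace n) : ∃ φ : Fin n → ℝ, ∃ V ∈ Matrix.unitaryGroup (Fin n) ℂ,
      V *ᵥ 1 = 1 ∧ V * posMatrix x * Vᴴ = dualPosMatrix g φ (fun k => eigenvalue g k x) ∧
      V * lax g x * Vᴴ = Matrix.diagonal fun j => (eigenvalue g j x : ℂ) := by
  obtain ⟨U, hU, hL⟩ := exists_unitary_lax_diagonal g x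
  obtain ⟨-, V, hV, φ, h⟩ := exists_rephasing hg hx hU hL
  exact ⟨φ, V, hV, h⟩

theorem exists_isActionAngle {n : ℕ} {g : ℝ} (hg : g ≠ 0) {x : (Fin n → ℝ) × (Fin n → ℝ)}
    (hx : x ∈ phaseSpace n) :
    ∃ φ : Fin n → ℝ, IsActionAngle g x φ fun k => eigenvalue g k x := by
  obtain ⟨φ, V, hV, h1, hQ, hL⟩ := exists_unitary_dual hg hx
  exact ⟨φ, eigenvalue_strictAnti hg hx, V, hV, unitary_conj_momentumValue g hV h1, hQ, hL⟩

/-! ### Characteristic polynomial, adjugate, and the formula for `θ` -/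

theorem smul_one_sub_lax_eq {n : ℕ} {g : ℝ} {x : (Fin n → ℝ) × (Fin n → ℝ)} {lam : Fin n → ℝ}
    {U : Matrix (Fin n) (Fin n) ℂ} (hU : U ∈ Matrix.unitaryGroup (Fin n) ℂ)
    (hL : U * lax g x * Uᴴ = Matrix.diagonal fun j => (lam j : ℂ)) (z : ℂ) :
    z • (1 : Matrix (Fin n) (Fin n) ℂ) - lax g x =
      Uᴴ * Matrix.diagonal (fun j => z - lam j) * U := by
  have h1 := unitary_conjTranspose_mul hU
  have hd : Matrix.diagonal (fun j => z - lam j) = z • (1 : Matrix (Fin n) (Fin n) ℂ) -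
      Matrix.diagonal fun j => (lam j : ℂ) := by
    ext i j
    by_cases h : i = j
    · subst h
      simp
    · simp [h]
  rw [hd, ← hL, Matrix.mul_sub, Matrix.sub_mul, Matrix.mul_smul, Matrix.smul_mul, Matrix.mul_one,
    h1]
  congr 1
  calc lax g x = (Uᴴ * U) * lax g x * (Uᴴ * U) := by rw [h1, Matrix.one_mul, Matrix.mul_one]
    _ = _ := by noncomm_ring

theorem polyA_eq_prod {n : ℕ} {g : ℝ} {x : (Fin n → ℝ) × (Fin n → ℝ)} {lam : Fin n → ℝ}
    {U : Matrix (Fin n) (Fin n) ℂ} (hU : U ∈ Matrix.unitaryGroup (Fin n) ℂ)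
    (hL : U * lax g x * Uᴴ = Matrix.diagonal fun j => (lam j : ℂ)) (z : ℂ) :
    polyA g x z = ∏ j, (z - lam j) := by
  rw [polyA, smul_one_sub_lax_eq hU hL, Matrix.det_mul_comm, ← Matrix.mul_assoc,
    unitary_mul_conjTranspose hU, Matrix.one_mul, Matrix.det_diagonal]

theorem polyA_eq_prod_eigenvalue {n : ℕ} (g : ℝ) (x : (Fin n → ℝ) × (Fin n → ℝ)) (z : ℂ) :
    polyA g x z = ∏ j, (z - eigenvalue g j x) := by
  obtain ⟨U, hU, hL⟩ := exists_unitary_lax_diagonal g x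
  exact polyA_eq_prod hU hL z

theorem deriv_polyA_eigenvalue {n : ℕ} (g : ℝ) (x : (Fin n → ℝ) × (Fin n → ℝ)) (k : Fin n) :
    deriv (polyA g x) (eigenvalue g k x) =
      ∏ l ∈ Finset.univ.erase k, ((eigenvalue g k x : ℂ) - eigenvalue g l x) := by
  have h : polyA g x = fun z : ℂ => (z - eigenvalue g k x) *
      ∏ j ∈ Finset.univ.erase k, (z - eigenvalue g j x) := by
    ext z
    rw [polyA_eq_prod_eigenvalue,
      Finset.mul_prod_erase _ (fun j => z - (eigenvalue g j x : ℂ)) (Finset.mem_univ k)]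
  rw [h, deriv_fun_mul (by fun_prop) (by fun_prop)]
  simp

theorem prod_erase_sub_ne_zero {n : ℕ} {lam : Fin n → ℝ} (hl : Function.Injective lam)
    (k : Fin n) : ∏ l ∈ Finset.univ.erase k, ((lam k : ℂ) - lam l) ≠ 0 := by
  rw [Finset.prod_ne_zero_iff]
  intro l hlk
  rw [sub_ne_zero]
  exact_mod_cast hl.ne (Finset.ne_of_mem_erase hlk).symm

/-- The adjugate of a diagonal matrix with a zero in position `k` is supported at `(k, k)`.
Conjugation carries this over, since the adjugate of each unitary factor is its determinant times
its inverse and the two determinants cancel. -/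
theorem adjugate_eigenvalue_sub_lax {n : ℕ} {g : ℝ} {x : (Fin n → ℝ) × (Fin n → ℝ)}
    {lam : Fin n → ℝ} {U : Matrix (Fin n) (Fin n) ℂ} (hU : U ∈ Matrix.unitaryGroup (Fin n) ℂ)
    (hL : U * lax g x * Uᴴ = Matrix.diagonal fun j => (lam j : ℂ)) (k : Fin n) :
    ((lam k : ℂ) • (1 : Matrix (Fin n) (Fin n) ℂ) - lax g x).adjugate =
      (∏ l ∈ Finset.univ.erase k, ((lam k : ℂ) - lam l)) •
        (Uᴴ * Matrix.single k k 1 * U) := by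
  have hadj : ∀ {V W : Matrix (Fin n) (Fin n) ℂ}, V * W = 1 → V.adjugate = V.det • W := by
    intro V W h
    calc V.adjugate = V.adjugate * (V * W) := by rw [h, Matrix.mul_one]
      _ = V.det • W := by
        rw [← Matrix.mul_assoc, Matrix.adjugate_mul, Matrix.smul_mul, Matrix.one_mul]
  have hd : Matrix.adjugate (Matrix.diagonal fun j => (lam k : ℂ) - lam j) =
      (∏ l ∈ Finset.univ.erase k, ((lam k : ℂ) - lam l)) • Matrix.single k k 1 := by
    rw [Matrix.adjugate_diagonal]
    ext i j
    by_cases h : i = j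
    · subst h
      by_cases hik : k = i
      · subst hik
        simp
      · have : ∏ l ∈ Finset.univ.erase i, ((lam k : ℂ) - lam l) = 0 :=
          Finset.prod_eq_zero (i := k) (by simp [hik]) (sub_self _)
        simp [this, hik]
    · have : ¬ (k = i ∧ k = j) := fun h' => h (h'.1.symm.trans h'.2)
      simp [h, this]
  have hdet : Uᴴ.det * U.det = 1 := by
    rw [← Matrix.det_mul, unitary_conjTranspose_mul hU, Matrix.det_one]
  rw [smul_one_sub_lax_eq hU hL, Matrix.adjugate_mul_distrib, Matrix.adjugate_mul_distrib, hd,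
    hadj (unitary_mul_conjTranspose hU), hadj (unitary_conjTranspose_mul hU)]
  simp only [Matrix.smul_mul, Matrix.mul_smul, smul_smul, Matrix.mul_assoc]
  congr 1
  linear_combination (∏ l ∈ Finset.univ.erase k, ((lam k : ℂ) - lam l)) * hdet

/-- Conjugation preserves the characteristic polynomial, hence the set of roots, and a set has at
most one strictly decreasing enumeration by `Fin n`. -/
theorem IsActionAngle.eq_eigenvalue {n : ℕ} {g : ℝ} (hg : g ≠ 0)
    {x : (Fin n → ℝ) × (Fin n → ℝ)} (hx : x ∈ phaseSpace n) {ψ ν : Fin n → ℝ}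
    (h : IsActionAngle g x ψ ν) : ν = fun k => eigenvalue g k x := by
  obtain ⟨hν, U, hU, -, -, hL⟩ := h
  have hprod : ∀ z : ℂ, ∏ j, (z - ν j) = ∏ j, (z - eigenvalue g j x) := fun z => by
    rw [← polyA_eq_prod hU hL, polyA_eq_prod_eigenvalue]
  refine (StrictAnti.range_inj hν (eigenvalue_strictAnti hg hx)).mp ?_
  have hmem : ∀ (f : Fin n → ℝ) (r : ℝ), r ∈ Set.range f ↔ ∏ j, ((r : ℂ) - f j) = 0 := by
    intro f r
    rw [Finset.prod_eq_zero_iff]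
    simp [sub_eq_zero, eq_comm]
  ext r
  rw [hmem, hmem, hprod]

/-- After `A'(λ_k)` cancels, what remains is `tr(Q̃ E_kk v v†)`, a column sum of `Q̃`. Only `U v v†
U† = v v†` is needed, so the phase left free by the stabilizer of `μ` is harmless. -/
theorem IsActionAngle.theta_eq {n : ℕ} {g : ℝ} (hg : g ≠ 0)
    {x : (Fin n → ℝ) × (Fin n → ℝ)} (hx : x ∈ phaseSpace n) {ψ ν : Fin n → ℝ}
    (h : IsActionAngle g x ψ ν) (k : Fin n) : theta g k x =
      (ψ k : ℂ) + Complex.I * g * ∑ l ∈ Finset.univ.erase k,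
        1 / ((eigenvalue g k x : ℂ) - eigenvalue g l x) := by
  obtain rfl := h.eq_eigenvalue hg hx
  obtain ⟨hν, U, hU, hμ, hQ, hL⟩ := h
  have hIg : (Complex.I * g : ℂ) ≠ 0 := by simp [hg]
  have hones : U * onesMatrix n * Uᴴ = onesMatrix n := by
    rw [momentumValue, Matrix.mul_smul, Matrix.smul_mul, Matrix.mul_sub, Matrix.sub_mul,
      Matrix.mul_one, unitary_mul_conjTranspose hU] at hμ
    exact sub_left_injective (smul_right_injective _ hIg hμ)
  have hne := prod_erase_sub_ne_zero hν.injective k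
  rw [theta, deriv_polyA_eigenvalue, polyC, adjugate_eigenvalue_sub_lax hU hL k, Matrix.mul_smul,
    Matrix.smul_mul, Matrix.trace_smul, smul_eq_mul, mul_div_cancel_left₀ _ hne]
  have htr : (posMatrix x * (Uᴴ * Matrix.single k k 1 * U) * onesMatrix n).trace =
      (dualPosMatrix g ψ (fun k => eigenvalue g k x) * Matrix.single k k 1 *
        onesMatrix n).trace := by
    have h1 := unitary_conjTranspose_mul hU
    calc (posMatrix x * (Uᴴ * Matrix.single k k 1 * U) * onesMatrix n).trace
        = ((Uᴴ * U) * (posMatrix x * (Uᴴ * Matrix.single k k 1 * U) * onesMatrix n)).trace := by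
          rw [h1, Matrix.one_mul]
      _ = (Uᴴ * (U * posMatrix x * Uᴴ * Matrix.single k k 1 * (U * onesMatrix n))).trace := by
          congr 1
          noncomm_ring
      _ = (U * posMatrix x * Uᴴ * Matrix.single k k 1 * (U * onesMatrix n * Uᴴ)).trace := by
          rw [Matrix.trace_mul_comm]
          congr 1
          noncomm_ring
      _ = _ := by rw [hones, hQ]
  rw [htr]
  have hent : ∀ j, (dualPosMatrix g ψ (fun k => eigenvalue g k x) * Matrix.single k k 1 *
        onesMatrix n : Matrix (Fin n) (Fin n) ℂ) j j = dualPosMatrix g ψ (fun k => eigenvalue g k x) j k := by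
    intro j
    simp [Matrix.mul_apply, onesMatrix_apply, Matrix.single_apply, ite_and]
  rw [Matrix.trace]
  simp only [Matrix.diag_apply, hent]
  rw [← Finset.add_sum_erase _ _ (Finset.mem_univ k), Finset.mul_sum]
  congr 1
  · simp [dualPosMatrix]
  · refine Finset.sum_congr rfl fun j hj => ?_
    rw [dualPosMatrix, Matrix.of_apply, if_neg (Finset.ne_of_mem_erase hj),
      ← neg_sub (eigenvalue g k x : ℂ) (eigenvalue g j x : ℂ), div_neg, neg_neg, mul_one_div]

/-- The angle variable conjugate to the `k`-th eigenvalue. -/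
noncomputable def angle {n : ℕ} (g : ℝ) (k : Fin n) (x : (Fin n → ℝ) × (Fin n → ℝ)) : ℝ :=
  (theta g k x).re

/-- The difference between `θ_k` and the angle is purely imaginary, so the real part recovers the
angle. -/
theorem IsActionAngle.eq_angle {n : ℕ} {g : ℝ} (hg : g ≠ 0)
    {x : (Fin n → ℝ) × (Fin n → ℝ)} (hx : x ∈ phaseSpace n) {ψ ν : Fin n → ℝ}
    (h : IsActionAngle g x ψ ν) : ψ = fun k => angle g k x := by
  ext k
  rw [angle, h.theta_eq hg hx]
  simp [Complex.mul_re]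

theorem isActionAngle_iff {n : ℕ} {g : ℝ} (hg : g ≠ 0)
    {x : (Fin n → ℝ) × (Fin n → ℝ)} (hx : x ∈ phaseSpace n) (ψ ν : Fin n → ℝ) :
    IsActionAngle g x ψ ν ↔ (ψ = fun k => angle g k x) ∧ ν = fun k => eigenvalue g k x := by
  refine ⟨fun h => ⟨h.eq_angle hg hx, h.eq_eigenvalue hg hx⟩, ?_⟩
  rintro ⟨rfl, rfl⟩
  obtain ⟨φ, hφ⟩ := exists_isActionAngle hg hx
  rwa [hφ.eq_angle hg hx] at hφ

theorem theta_eq_angle_add {n : ℕ} {g : ℝ} (hg : g ≠ 0)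
    {x : (Fin n → ℝ) × (Fin n → ℝ)} (hx : x ∈ phaseSpace n) (k : Fin n) : theta g k x =
      (angle g k x : ℂ) + Complex.I * g * ∑ l ∈ Finset.univ.erase k,
        1 / ((eigenvalue g k x : ℂ) - eigenvalue g l x) :=
  ((isActionAngle_iff hg hx _ _).mpr ⟨rfl, rfl⟩).theta_eq hg hx k

/-! ### Smoothness of eigenvalues, angles and frame -/

theorem contDiffAt_complex_div {E : Type*} [NormedAddCommGroup E] [NormedSpace ℝ E] {r : ℕ∞ω}
    {f h : E → ℂ} {x : E} (hf : ContDiffAt ℝ r f x) (hh : ContDiffAt ℝ r h x) (h0 : h x ≠ 0) :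
    ContDiffAt ℝ r (fun y => f y / h y) x := by
  simp only [div_eq_mul_inv]
  exact hf.mul (hh.inv h0)

theorem contDiffAt_det {E : Type*} [NormedAddCommGroup E] [NormedSpace ℝ E] {n : ℕ} {r : ℕ∞ω}
    {M : E → Matrix (Fin n) (Fin n) ℂ} {x : E}
    (h : ∀ i j, ContDiffAt ℝ r (fun y => M y i j) x) : ContDiffAt ℝ r (fun y => (M y).det) x := by
  simp only [Matrix.det_apply]
  exact ContDiffAt.sum fun σ _ => ContDiffAt.const_smul _ (contDiffAt_prod fun i _ => h _ _)

theorem contDiffAt_adjugate {E : Type*} [NormedAddCommGroup E] [NormedSpace ℝ E] {n : ℕ}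
    {r : ℕ∞ω} {M : E → Matrix (Fin n) (Fin n) ℂ} {x : E}
    (h : ∀ i j, ContDiffAt ℝ r (fun y => M y i j) x) (i j : Fin n) :
    ContDiffAt ℝ r (fun y => (M y).adjugate i j) x := by
  simp only [Matrix.adjugate_apply]
  refine contDiffAt_det fun a b => ?_
  by_cases ha : a = j
  · simpa [Matrix.updateRow_apply, ha] using contDiffAt_const
  · simpa [Matrix.updateRow_apply, ha] using h a b

theorem exists_contDiffAt_implicit {E : Type*} [NormedAddCommGroup E] [NormedSpace ℝ E]
    [CompleteSpace E] {r : ℕ∞ω} (hr : r ≠ 0) {f : E × ℝ → ℝ} {x : E} {t c : ℝ}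
    (hf : ContDiffAt ℝ r f (x, t)) (h0 : f (x, t) = 0)
    (hd : HasDerivAt (fun s => f (x, s)) c t) (hc : c ≠ 0) :
    ∃ ψ : E → ℝ, ContDiffAt ℝ r ψ x ∧ ψ x = t ∧ ∀ᶠ y in nhds x, f (y, ψ y) = 0 := by
  have hinv : (fderiv ℝ f (x, t) ∘L .inr ℝ E ℝ).IsInvertible := by
    refine ⟨ContinuousLinearEquiv.unitsEquivAut ℝ (Units.mk0 c hc), ?_⟩
    ext
    have h1 : HasFDerivAt (fun s : ℝ => ((x, s) : E × ℝ)) (ContinuousLinearMap.inr ℝ E ℝ) t :=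
      hasFDerivAt_prodMk_right x t
    have h2 := ((hf.differentiableAt hr).hasFDerivAt.comp t h1).hasDerivAt.unique hd
    simpa using h2.symm
  refine ⟨hf.implicitFunction hr hinv, hf.contDiffAt_implicitFunction hr hinv,
    hf.implicitFunction_apply_self hr hinv, ?_⟩
  simpa [h0] using hf.eventually_apply_implicitFunction hr hinv

theorem isOpen_phaseSpace (n : ℕ) : IsOpen (phaseSpace n) := by
  have : phaseSpace n = ⋂ i : Fin n, ⋂ j : Fin n, ⋂ _ : i < j, {x | x.1 j < x.1 i} := by
    ext x
    simp [phaseSpace, configSpace, StrictAnti]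
  rw [this]
  refine isOpen_iInter_of_finite fun i => isOpen_iInter_of_finite fun j =>
    isOpen_iInter_of_finite fun _ => isOpen_lt (by fun_prop) (by fun_prop)

theorem contDiffAt_lax {n : ℕ} (g : ℝ) {x : (Fin n → ℝ) × (Fin n → ℝ)}
    (hx : x ∈ phaseSpace n) (j k : Fin n) : ContDiffAt ℝ ∞ (fun y => lax g y j k) x := by
  have hc : ContDiff ℝ ∞ fun r : ℝ => (r : ℂ) := Complex.ofRealCLM.contDiff
  by_cases h : j = k
  · simp only [lax, Matrix.of_apply, if_pos h]
    fun_prop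
  · simp only [lax, Matrix.of_apply, if_neg h]
    refine contDiffAt_complex_div (by fun_prop) (by fun_prop) ?_
    rw [sub_ne_zero]
    exact_mod_cast (StrictAnti.injective hx).ne h

theorem contDiffAt_smul_one_sub_lax {n : ℕ} (g : ℝ) {E : Type*} [NormedAddCommGroup E]
    [NormedSpace ℝ E] {f : E → (Fin n → ℝ) × (Fin n → ℝ)} {t : E → ℝ} {u : E}
    (hf : ContDiffAt ℝ ∞ f u) (ht : ContDiffAt ℝ ∞ t u) (hx : f u ∈ phaseSpace n) (j k : Fin n) :
    ContDiffAt ℝ ∞ (fun y =>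
      ((t y : ℂ) • (1 : Matrix (Fin n) (Fin n) ℂ) - lax g (f y)) j k) u := by
  have hc : ContDiff ℝ ∞ fun r : ℝ => (r : ℂ) := Complex.ofRealCLM.contDiff
  have h1 : ContDiffAt ℝ ∞ (fun y => lax g (f y) j k) u := (contDiffAt_lax g hx j k).comp u hf
  have h2 : ContDiffAt ℝ ∞ (fun y => (t y : ℂ)) u := hc.contDiffAt.comp u ht
  simp only [Matrix.sub_apply, Matrix.smul_apply, smul_eq_mul]
  exact (h2.mul contDiffAt_const).sub h1

/-- Near a point of the phase space the eigenvalues are the local roots that the implicit function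
theorem provides. -/
theorem contDiffAt_eigenvalue {n : ℕ} {g : ℝ} (hg : g ≠ 0) {x : (Fin n → ℝ) × (Fin n → ℝ)}
    (hx : x ∈ phaseSpace n) (k : Fin n) : ContDiffAt ℝ ∞ (eigenvalue g k) x := by
  let f : ((Fin n → ℝ) × (Fin n → ℝ)) × ℝ → ℝ := fun u => ∏ j, (u.2 - eigenvalue g j u.1)
  -- The determinant form shows that `f` is smooth without presupposing smooth eigenvalues.
  have hfA : ∀ u, f u = (polyA g u.1 u.2).re := by
    intro u
    rw [polyA_eq_prod_eigenvalue, ← Complex.ofReal_re (f u)]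
    simp only [f]
    push_cast
    rfl
  have hf : ∀ t, ContDiffAt ℝ ∞ f (x, t) := by
    intro t
    have h : ContDiffAt ℝ ∞ (fun u : ((Fin n → ℝ) × (Fin n → ℝ)) × ℝ => polyA g u.1 u.2) (x, t) :=
      contDiffAt_det fun i j =>
        contDiffAt_smul_one_sub_lax g contDiffAt_fst contDiffAt_snd hx i j
    rw [funext hfA]
    exact Complex.reCLM.contDiff.contDiffAt.comp _ h
  have hex : ∀ i : Fin n, ∃ ψ : (Fin n → ℝ) × (Fin n → ℝ) → ℝ, ContDiffAt ℝ ∞ ψ x ∧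
      ψ x = eigenvalue g i x ∧ ∀ᶠ y in nhds x, f (y, ψ y) = 0 := by
    intro i
    refine exists_contDiffAt_implicit (by simp) (hf _)
      (Finset.prod_eq_zero (Finset.mem_univ i) (sub_self _))
      (c := ∏ l ∈ Finset.univ.erase i, (eigenvalue g i x - eigenvalue g l x)) ?_ ?_
    · have h := HasDerivAt.fun_mul ((hasDerivAt_id' (eigenvalue g i x)).sub_const (eigenvalue g i x))
        (DifferentiableAt.hasDerivAt (f := fun s =>
          ∏ l ∈ Finset.univ.erase i, (s - eigenvalue g l x)) (by fun_prop))
      rw [sub_self, zero_mul, add_zero, one_mul] at h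
      refine h.congr_of_eventuallyEq (Filter.Eventually.of_forall fun s => ?_)
      exact (Finset.mul_prod_erase _ (fun j => s - eigenvalue g j x) (Finset.mem_univ i)).symm
    · rw [Finset.prod_ne_zero_iff]
      intro l hl
      exact sub_ne_zero.mpr
        ((eigenvalue_strictAnti hg hx).injective.ne (Finset.ne_of_mem_erase hl).symm)
  choose ψ hψ hψx hroot using hex
  have hanti : ∀ᶠ y in nhds x, StrictAnti fun i => ψ i y := by
    have : ∀ᶠ y in nhds x, ∀ i j : Fin n, i < j → ψ j y < ψ i y := by
      rw [Filter.eventually_all]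
      intro i
      rw [Filter.eventually_all]
      intro j
      by_cases hij : i < j
      · have hlt : ψ j x < ψ i x := by
          rw [hψx, hψx]
          exact eigenvalue_strictAnti hg hx hij
        filter_upwards [(hψ j).continuousAt.eventually_lt (hψ i).continuousAt hlt] with y hy _
          using hy
      · exact Filter.Eventually.of_forall fun y h => absurd h hij
    filter_upwards [this] with y hy i j hij using hy i j hij
  refine (hψ k).congr_of_eventuallyEq ?_
  filter_upwards [hanti, Filter.eventually_all.mpr hroot, (isOpen_phaseSpace n).mem_nhds hx]
    with y hy1 hy2 hy3
  have hlam := eigenvalue_strictAnti hg hy3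
  -- The `n` local roots stay distinct near `x` by continuity, so they exhaust the spectrum, and
  -- their order identifies each with an eigenvalue.
  have hsub : Set.range (fun i => ψ i y) ⊆ Set.range fun i => eigenvalue g i y := by
    rintro _ ⟨i, rfl⟩
    obtain ⟨j, -, hj⟩ := Finset.prod_eq_zero_iff.mp (hy2 i)
    exact ⟨j, (sub_eq_zero.mp hj).symm⟩
  have heq : Set.range (fun i => ψ i y) = Set.range fun i => eigenvalue g i y := by
    refine Set.eq_of_subset_of_ncard_le hsub ?_ (Set.finite_range _)
    rw [← Set.image_univ, ← Set.image_univ, Set.ncard_image_of_injective _ hlam.injective,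
      Set.ncard_image_of_injective _ hy1.injective]
  exact (congrFun ((StrictAnti.range_inj hy1 hlam).mp heq) k).symm

theorem contDiffAt_ofReal_eigenvalue {n : ℕ} {g : ℝ} (hg : g ≠ 0)
    {x : (Fin n → ℝ) × (Fin n → ℝ)} (hx : x ∈ phaseSpace n) (k : Fin n) :
    ContDiffAt ℝ ∞ (fun y => (eigenvalue g k y : ℂ)) x :=
  Complex.ofRealCLM.contDiff.contDiffAt.comp x (contDiffAt_eigenvalue hg hx k)

theorem contDiffAt_prod_erase {n : ℕ} {g : ℝ} (hg : g ≠ 0) {x : (Fin n → ℝ) × (Fin n → ℝ)}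
    (hx : x ∈ phaseSpace n) (k : Fin n) :
    ContDiffAt ℝ ∞ (fun y =>
      ∏ l ∈ Finset.univ.erase k, ((eigenvalue g k y : ℂ) - eigenvalue g l y)) x :=
  contDiffAt_prod fun l _ =>
    (contDiffAt_ofReal_eigenvalue hg hx k).sub (contDiffAt_ofReal_eigenvalue hg hx l)

theorem contDiffAt_adjugate_eigenvalue {n : ℕ} {g : ℝ} (hg : g ≠ 0)
    {x : (Fin n → ℝ) × (Fin n → ℝ)} (hx : x ∈ phaseSpace n) (k i j : Fin n) :
    ContDiffAt ℝ ∞ (fun y => ((eigenvalue g k y : ℂ) • (1 : Matrix (Fin n) (Fin n) ℂ) -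
      lax g y).adjugate i j) x :=
  contDiffAt_adjugate (fun i j => contDiffAt_smul_one_sub_lax g contDiffAt_id
    (contDiffAt_eigenvalue hg hx k) hx i j) i j

theorem contDiffAt_theta {n : ℕ} {g : ℝ} (hg : g ≠ 0) {x : (Fin n → ℝ) × (Fin n → ℝ)}
    (hx : x ∈ phaseSpace n) (k : Fin n) : ContDiffAt ℝ ∞ (theta g k) x := by
  have hc : ContDiff ℝ ∞ fun r : ℝ => (r : ℂ) := Complex.ofRealCLM.contDiff
  have h : theta g k = fun y => (∑ i, ∑ j, (y.1 i : ℂ) * ((eigenvalue g k y : ℂ) •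
      (1 : Matrix (Fin n) (Fin n) ℂ) - lax g y).adjugate i j) /
      ∏ l ∈ Finset.univ.erase k, ((eigenvalue g k y : ℂ) - eigenvalue g l y) := by
    ext y
    rw [theta, deriv_polyA_eigenvalue, polyC, Matrix.trace]
    simp only [Matrix.diag_apply, Matrix.mul_apply (N := onesMatrix n), onesMatrix_apply, mul_one,
      posMatrix, Matrix.diagonal_mul]
  rw [h]
  refine contDiffAt_complex_div ?_ (contDiffAt_prod_erase hg hx k)
    (prod_erase_sub_ne_zero (eigenvalue_strictAnti hg hx).injective k)
  exact ContDiffAt.sum fun i _ => ContDiffAt.sum fun j _ =>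
    ContDiffAt.mul (by fun_prop) (contDiffAt_adjugate_eigenvalue hg hx k i j)

theorem contDiffAt_angle {n : ℕ} {g : ℝ} (hg : g ≠ 0) {x : (Fin n → ℝ) × (Fin n → ℝ)}
    (hx : x ∈ phaseSpace n) (k : Fin n) : ContDiffAt ℝ ∞ (angle g k) x :=
  Complex.reCLM.contDiff.contDiffAt.comp x (contDiffAt_theta hg hx k)

/-- The matrix whose columns are the normalized eigenvectors of `L` with coordinate sum one. -/
noncomputable def dualFrame {n : ℕ} (g : ℝ) (x : (Fin n → ℝ) × (Fin n → ℝ)) :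
    Matrix (Fin n) (Fin n) ℂ :=
  Matrix.of fun j k => (∑ i, ((eigenvalue g k x : ℂ) • (1 : Matrix (Fin n) (Fin n) ℂ) -
      lax g x).adjugate j i) /
    ∏ l ∈ Finset.univ.erase k, ((eigenvalue g k x : ℂ) - eigenvalue g l x)

/-- A unitary chosen pointwise by the spectral theorem need not vary smoothly; this frame does,
being a rational expression in `L` and the eigenvalues. -/
theorem contDiffAt_dualFrame {n : ℕ} {g : ℝ} (hg : g ≠ 0) {x : (Fin n → ℝ) × (Fin n → ℝ)}
    (hx : x ∈ phaseSpace n) (j k : Fin n) : ContDiffAt ℝ ∞ (fun y => dualFrame g y j k) x := by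
  simp only [dualFrame, Matrix.of_apply]
  refine contDiffAt_complex_div ?_ (contDiffAt_prod_erase hg hx k)
    (prod_erase_sub_ne_zero (eigenvalue_strictAnti hg hx).injective k)
  exact ContDiffAt.sum fun i _ => contDiffAt_adjugate_eigenvalue hg hx k j i

/-- The dual frame is the inverse of the unitary matrix of the action-angle map. -/
theorem exists_dualFrame_eq {n : ℕ} {g : ℝ} (hg : g ≠ 0) {x : (Fin n → ℝ) × (Fin n → ℝ)}
    (hx : x ∈ phaseSpace n) : ∃ U ∈ Matrix.unitaryGroup (Fin n) ℂ, dualFrame g x = Uᴴ ∧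
      U *ᵥ 1 = 1 ∧
      U * posMatrix x * Uᴴ = dualPosMatrix g (fun k => angle g k x) (fun k => eigenvalue g k x) ∧
      U * lax g x * Uᴴ = Matrix.diagonal fun j => (eigenvalue g j x : ℂ) := by
  obtain ⟨φ, U, hU, h1, hQ, hL⟩ := exists_unitary_dual hg hx
  have hφ : IsActionAngle g x φ fun k => eigenvalue g k x :=
    ⟨eigenvalue_strictAnti hg hx, U, hU, unitary_conj_momentumValue g hU h1, hQ, hL⟩
  refine ⟨U, hU, ?_, h1, by rw [hQ, hφ.eq_angle hg hx], hL⟩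
  ext j k
  have hne := prod_erase_sub_ne_zero (eigenvalue_strictAnti hg hx).injective k
  have hsum : ∑ i, U k i = 1 := by
    simpa [Matrix.mulVec, dotProduct] using congrFun h1 k
  rw [dualFrame, Matrix.of_apply,
    adjugate_eigenvalue_sub_lax (lam := fun k => eigenvalue g k x) hU hL k]
  simp only [Matrix.smul_apply, smul_eq_mul]
  rw [← Finset.mul_sum, mul_div_cancel_left₀ _ hne]
  have : ∀ i, (Uᴴ * Matrix.single k k 1 * U : Matrix (Fin n) (Fin n) ℂ) j i = Uᴴ j k * U k i := by
    intro i
    simp [Matrix.mul_apply, Matrix.single_apply, ite_and]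
  simp only [this]
  rw [← Finset.mul_sum, hsum, mul_one]

/-! ### Calculus of matrix-valued functions -/

/-- The entrywise derivative of a matrix valued function at `x` in the direction `ξ`. -/
noncomputable def matDeriv {E : Type*} [NormedAddCommGroup E] [NormedSpace ℝ E] {n : ℕ}
    (M : E → Matrix (Fin n) (Fin n) ℂ) (x ξ : E) : Matrix (Fin n) (Fin n) ℂ :=
  Matrix.of fun i j => fderiv ℝ (fun y => M y i j) x ξ

section matDeriv

variable {E : Type*} [NormedAddCommGroup E] [NormedSpace ℝ E] {n : ℕ}
  {M N : E → Matrix (Fin n) (Fin n) ℂ} {x : E}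

theorem matDeriv_const (A : Matrix (Fin n) (Fin n) ℂ) (x ξ : E) :
    matDeriv (fun _ => A) x ξ = 0 := by
  ext i j
  simp [matDeriv]

theorem matDeriv_congr (h : ∀ᶠ y in nhds x, M y = N y) (ξ : E) :
    matDeriv M x ξ = matDeriv N x ξ := by
  ext i j
  rw [matDeriv, matDeriv, Matrix.of_apply, Matrix.of_apply, Filter.EventuallyEq.fderiv_eq]
  filter_upwards [h] with y hy
  rw [hy]

theorem matDeriv_mul (hM : ∀ i j, DifferentiableAt ℝ (fun y => M y i j) x)
    (hN : ∀ i j, DifferentiableAt ℝ (fun y => N y i j) x) (ξ : E) :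
    matDeriv (fun y => M y * N y) x ξ = matDeriv M x ξ * N x + M x * matDeriv N x ξ := by
  ext i j
  simp only [matDeriv, Matrix.add_apply, Matrix.mul_apply, Matrix.of_apply]
  rw [fderiv_fun_sum (A := fun k y => M y i k * N y k j) fun k _ => (hM i k).mul (hN k j),
    sum_apply, ← Finset.sum_add_distrib]
  refine Finset.sum_congr rfl fun k _ => ?_
  rw [fderiv_fun_mul (hM i k) (hN k j)]
  simp only [add_apply, smul_apply, smul_eq_mul]
  ring

theorem differentiableAt_matMul (hM : ∀ i j, DifferentiableAt ℝ (fun y => M y i j) x)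
    (hN : ∀ i j, DifferentiableAt ℝ (fun y => N y i j) x) (i j : Fin n) :
    DifferentiableAt ℝ (fun y => (M y * N y) i j) x := by
  simp only [Matrix.mul_apply]
  exact DifferentiableAt.fun_sum fun k _ => (hM i k).mul (hN k j)

theorem matDeriv_sub (hM : ∀ i j, DifferentiableAt ℝ (fun y => M y i j) x)
    (hN : ∀ i j, DifferentiableAt ℝ (fun y => N y i j) x) (ξ : E) :
    matDeriv (fun y => M y - N y) x ξ = matDeriv M x ξ - matDeriv N x ξ := by
  ext i j
  simp only [matDeriv, Matrix.sub_apply, Matrix.of_apply]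
  rw [fderiv_fun_sub (hM i j) (hN i j), sub_apply]

end matDeriv

/-! ### Trace identities and symplectic linear algebra -/

/-- The variation of a matrix that is conjugated by a moving frame `W`. -/
theorem frame_conj_eq {n : ℕ} {U W dW L dL Λ dΛ : Matrix (Fin n) (Fin n) ℂ} (hUW : U * W = 1)
    (hLW : L * W = W * Λ) (hd : dL * W + L * dW = dW * Λ + W * dΛ) :
    U * dL * W = dΛ + (U * dW * Λ - Λ * (U * dW)) := by
  have hWU : W * U = 1 := mul_eq_one_comm.mp hUW
  have hUL : U * L = Λ * U := by
    calc U * L = U * (L * W) * U := by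
          rw [Matrix.mul_assoc U, Matrix.mul_assoc L, hWU, Matrix.mul_one]
      _ = (U * W) * Λ * U := by rw [hLW]; noncomm_ring
      _ = Λ * U := by rw [hUW, Matrix.one_mul]
  calc U * dL * W = U * (dL * W + L * dW) - U * L * dW := by noncomm_ring
    _ = U * dW * Λ + U * W * dΛ - U * L * dW := by rw [hd]; noncomm_ring
    _ = _ := by rw [hUW, hUL]; noncomm_ring

/-- Here `A, B` and `A', B'` stand for `dQ̃, dΛ` in two directions, and the hypotheses are the
differentiated constraint. Traced against `Z'` and `Z` they cancel the terms linear in the frame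
variation; cyclicity gathers the quadratic ones. -/
theorem trace_symplectic_identity {n : ℕ} {A A' B B' Z Z' Q Λ : Matrix (Fin n) (Fin n) ℂ}
    (h : (A * Λ - Λ * A) + (Q * B - B * Q) = 0) (h' : (A' * Λ - Λ * A') + (Q * B' - B' * Q) = 0) :
    ((A + (Z * Q - Q * Z)) * (B' + (Z' * Λ - Λ * Z'))).trace -
      ((A' + (Z' * Q - Q * Z')) * (B + (Z * Λ - Λ * Z))).trace =
    (A * B').trace - (A' * B).trace + ((Q * Λ - Λ * Q) * (Z * Z' - Z' * Z)).trace := by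
  have t := congrArg (fun M => (Z' * M).trace) h
  have t' := congrArg (fun M => (Z * M).trace) h'
  have c3 : ∀ X Y V : Matrix (Fin n) (Fin n) ℂ,
      (X * (Y * V)).trace = (Y * (V * X)).trace := fun X Y V => by
    rw [Matrix.trace_mul_comm, Matrix.mul_assoc]
  have c4 : ∀ X Y V T : Matrix (Fin n) (Fin n) ℂ,
      (X * (Y * (V * T))).trace = (Y * (V * (T * X))).trace := fun X Y V T => by
    rw [Matrix.trace_mul_comm, Matrix.mul_assoc, Matrix.mul_assoc]
  simp only [Matrix.mul_add, Matrix.add_mul, Matrix.mul_sub, Matrix.sub_mul, Matrix.trace_add,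
    Matrix.trace_sub, Matrix.mul_assoc, Matrix.mul_zero, Matrix.trace_zero] at t t' ⊢
  linear_combination t' - t - c3 Q Z B' - c3 A' Z Λ - c3 Z A' Λ + c3 Q Z' B + c3 A Z' Λ +
    c3 Z' A Λ + c4 Z Q Z' Λ - c4 Z' Q Z Λ - c4 Z Q Λ Z' + c4 Z' Q Λ Z + c4 Λ Q Z Z' - c4 Λ Q Z' Z

/-- If `ω(ξ, η) = ∑ (a_j ∧ b_j)(ξ, η)`, then `a`, `b` satisfy the canonical bracket relations. -/
theorem canonical_of_symplectic {n : ℕ} {a b : Fin n → (Fin n → ℝ) × (Fin n → ℝ) → ℂ}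
    (h : ∀ ξ η : (Fin n → ℝ) × (Fin n → ℝ), ∑ j, (a j ξ * b j η - a j η * b j ξ) =
      ∑ j, ((ξ.1 j : ℂ) * η.2 j - η.1 j * ξ.2 j)) (j k : Fin n) :
    ∑ i, (a j (Pi.single i 1, 0) * a k (0, Pi.single i 1) -
        a j (0, Pi.single i 1) * a k (Pi.single i 1, 0)) = 0 ∧
    ∑ i, (a j (Pi.single i 1, 0) * b k (0, Pi.single i 1) -
        a j (0, Pi.single i 1) * b k (Pi.single i 1, 0)) = (if j = k then 1 else 0) ∧
    ∑ i, (b j (Pi.single i 1, 0) * b k (0, Pi.single i 1) -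
        b j (0, Pi.single i 1) * b k (Pi.single i 1, 0)) = 0 := by
  let eq : Fin n → (Fin n → ℝ) × (Fin n → ℝ) := fun i => (Pi.single i 1, 0)
  let ep : Fin n → (Fin n → ℝ) × (Fin n → ℝ) := fun i => (0, Pi.single i 1)
  let A : Matrix (Fin n) (Fin n) ℂ := Matrix.of fun j i => a j (eq i)
  let B : Matrix (Fin n) (Fin n) ℂ := Matrix.of fun j i => a j (ep i)
  let C : Matrix (Fin n) (Fin n) ℂ := Matrix.of fun j i => b j (eq i)
  let D : Matrix (Fin n) (Fin n) ℂ := Matrix.of fun j i => b j (ep i)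
  have h1 : Aᵀ * C - Cᵀ * A = 0 := by
    ext i l
    have := h (eq i) (eq l)
    simp only [Matrix.sub_apply, Matrix.mul_apply, Matrix.transpose_apply, A, C, Matrix.of_apply,
      Matrix.zero_apply, ← Finset.sum_sub_distrib]
    simpa [eq, mul_comm] using this
  have h2 : Bᵀ * D - Dᵀ * B = 0 := by
    ext i l
    have := h (ep i) (ep l)
    simp only [Matrix.sub_apply, Matrix.mul_apply, Matrix.transpose_apply, B, D, Matrix.of_apply,
      Matrix.zero_apply, ← Finset.sum_sub_distrib]
    simpa [ep, mul_comm] using this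
  have h3 : Aᵀ * D - Cᵀ * B = 1 := by
    ext i l
    have := h (eq i) (ep l)
    simp only [Matrix.sub_apply, Matrix.mul_apply, Matrix.transpose_apply, A, B, C, D,
      Matrix.of_apply, ← Finset.sum_sub_distrib]
    simpa [eq, ep, mul_comm, Pi.single_apply, Matrix.one_apply, apply_ite Complex.ofReal, eq_comm]
      using this
  -- The hypothesis says that the Jacobian `S` satisfies `Sᵀ J S = J`. The minus signs come from the
  -- convention for `Matrix.J`, whose upper right block is `-1`.
  have hS : Matrix.fromBlocks A B C D ∈ Matrix.symplecticGroup (Fin n) ℂ := by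
    rw [SymplecticGroup.mem_iff', Matrix.fromBlocks_transpose, Matrix.J,
      Matrix.fromBlocks_multiply, Matrix.fromBlocks_multiply, Matrix.fromBlocks_inj]
    have h4 : Bᵀ * C - Dᵀ * A = -1 := by
      have := congrArg Matrix.transpose h3
      simp only [Matrix.transpose_sub, Matrix.transpose_mul, Matrix.transpose_transpose,
        Matrix.transpose_one] at this
      rw [← this, neg_sub]
    refine ⟨?_, ?_, ?_, ?_⟩
    · convert! congrArg Neg.neg h1 using 1 <;> first | abel1 | noncomm_ring
    · convert! congrArg Neg.neg h3 using 1
      noncomm_ring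
    · convert! congrArg Neg.neg h4 using 1 <;> first | abel1 | noncomm_ring
    · convert! congrArg Neg.neg h2 using 1 <;> first | abel1 | noncomm_ring
  -- The equivalent identity `S J Sᵀ = J` has the brackets as its entries.
  have hT := SymplecticGroup.mem_iff.mp hS
  rw [Matrix.fromBlocks_transpose, Matrix.J, Matrix.fromBlocks_multiply,
    Matrix.fromBlocks_multiply, Matrix.fromBlocks_inj] at hT
  obtain ⟨k1, k2, -, k4⟩ := hT
  have hent : ∀ X Y V T : Matrix (Fin n) (Fin n) ℂ, ∑ i, (X j i * Y k i - V j i * T k i) =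
      (X * Yᵀ - V * Tᵀ) j k := by
    intro X Y V T
    simp [Matrix.mul_apply]
  have m1 : A * Bᵀ - B * Aᵀ = 0 := by
    convert! congrArg Neg.neg k1 using 1 <;> first | abel1 | noncomm_ring
  have m2 : A * Dᵀ - B * Cᵀ = 1 := by
    convert! congrArg Neg.neg k2 using 1 <;> first | abel1 | noncomm_ring
  have m4 : C * Dᵀ - D * Cᵀ = 0 := by
    convert! congrArg Neg.neg k4 using 1 <;> first | abel1 | noncomm_ring
  refine ⟨?_, ?_, ?_⟩
  · exact (hent A B B A).trans (by rw [m1, Matrix.zero_apply])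
  · exact (hent A D B C).trans (by rw [m2, Matrix.one_apply])
  · exact (hent C D D C).trans (by rw [m4, Matrix.zero_apply])

/-- The identity part of `μ` sees the trace of a commutator; the `v v†` part vanishes because `Z`
and `Z'` kill `v`. -/
theorem trace_momentumValue_mul_commutator {n : ℕ} (g : ℝ) {Z Z' : Matrix (Fin n) (Fin n) ℂ}
    (hZ : Z * onesMatrix n = 0) (hZ' : Z' * onesMatrix n = 0) :
    (momentumValue n g * (Z * Z' - Z' * Z)).trace = 0 := by
  have h : ((Z * Z' - Z' * Z) * onesMatrix n).trace = 0 := by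
    rw [Matrix.sub_mul, Matrix.mul_assoc, Matrix.mul_assoc, hZ, hZ']
    simp
  rw [momentumValue, Matrix.smul_mul, Matrix.trace_smul, Matrix.sub_mul, Matrix.one_mul,
    Matrix.trace_sub, Matrix.trace_mul_comm, h, Matrix.trace_sub, Matrix.trace_mul_comm Z Z']
  simp

/-! ### Canonical coordinates -/

section tangent

variable {n : ℕ} {g : ℝ} {x : (Fin n → ℝ) × (Fin n → ℝ)}

theorem differentiableAt_posMatrix (x : (Fin n → ℝ) × (Fin n → ℝ)) (i j : Fin n) :
    DifferentiableAt ℝ (fun y => posMatrix y i j) x := by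
  have hc : Differentiable ℝ fun r : ℝ => (r : ℂ) := Complex.ofRealCLM.differentiable
  by_cases h : i = j
  · subst h
    simp only [posMatrix, Matrix.diagonal_apply_eq]
    fun_prop
  · simp only [posMatrix, Matrix.diagonal_apply_ne _ h]
    fun_prop

theorem differentiableAt_lax (hx : x ∈ phaseSpace n) (i j : Fin n) :
    DifferentiableAt ℝ (fun y => lax g y i j) x :=
  (contDiffAt_lax g hx i j).differentiableAt (by simp)

theorem differentiableAt_dualFrame (hg : g ≠ 0) (hx : x ∈ phaseSpace n) (i j : Fin n) :
    DifferentiableAt ℝ (fun y => dualFrame g y i j) x :=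
  (contDiffAt_dualFrame hg hx i j).differentiableAt (by simp)

theorem differentiableAt_eigenvalue (hg : g ≠ 0) (hx : x ∈ phaseSpace n) (k : Fin n) :
    DifferentiableAt ℝ (fun y => (eigenvalue g k y : ℂ)) x :=
  (contDiffAt_ofReal_eigenvalue hg hx k).differentiableAt (by simp)

theorem differentiableAt_angle (hg : g ≠ 0) (hx : x ∈ phaseSpace n) (k : Fin n) :
    DifferentiableAt ℝ (fun y => (angle g k y : ℂ)) x :=
  (Complex.ofRealCLM.contDiff.contDiffAt.comp x (contDiffAt_angle hg hx k)).differentiableAt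
    (n := ∞) (by simp)

/-- The diagonal matrix of the eigenvalues. -/
noncomputable def actionMatrix {n : ℕ} (g : ℝ) (x : (Fin n → ℝ) × (Fin n → ℝ)) :
    Matrix (Fin n) (Fin n) ℂ :=
  Matrix.diagonal fun j => (eigenvalue g j x : ℂ)

/-- The dual form of `Q`. -/
noncomputable def angleMatrix {n : ℕ} (g : ℝ) (x : (Fin n → ℝ) × (Fin n → ℝ)) :
    Matrix (Fin n) (Fin n) ℂ :=
  dualPosMatrix g (fun k => angle g k x) (fun k => eigenvalue g k x)

theorem differentiableAt_actionMatrix (hg : g ≠ 0) (hx : x ∈ phaseSpace n) (i j : Fin n) :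
    DifferentiableAt ℝ (fun y => actionMatrix g y i j) x := by
  by_cases h : i = j
  · subst h
    simpa only [actionMatrix, Matrix.diagonal_apply_eq] using differentiableAt_eigenvalue hg hx i
  · simp only [actionMatrix, Matrix.diagonal_apply_ne _ h]
    fun_prop

theorem differentiableAt_angleMatrix (hg : g ≠ 0) (hx : x ∈ phaseSpace n) (i j : Fin n) :
    DifferentiableAt ℝ (fun y => angleMatrix g y i j) x := by
  by_cases h : i = j
  · subst h
    simpa only [angleMatrix, dualPosMatrix, Matrix.of_apply, if_true] using
      differentiableAt_angle hg hx i
  · simp only [angleMatrix, dualPosMatrix, Matrix.of_apply, if_neg h, div_eq_mul_inv]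
    refine (DifferentiableAt.const_mul (DifferentiableAt.inv ((differentiableAt_eigenvalue hg hx
      i).sub (differentiableAt_eigenvalue hg hx j)) ?_) _).neg
    rw [Pi.sub_apply, sub_ne_zero]
    exact_mod_cast (eigenvalue_strictAnti hg hx).injective.ne h

theorem matDeriv_posMatrix (x ξ : (Fin n → ℝ) × (Fin n → ℝ)) :
    matDeriv posMatrix x ξ = Matrix.diagonal fun j => (ξ.1 j : ℂ) := by
  ext i j
  by_cases h : i = j
  · subst h
    simp only [matDeriv, Matrix.of_apply, posMatrix, Matrix.diagonal_apply_eq]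
    have := (Complex.ofRealCLM ∘L ContinuousLinearMap.proj i ∘L
      ContinuousLinearMap.fst ℝ (Fin n → ℝ) (Fin n → ℝ)).hasFDerivAt (x := x)
    exact congrArg (fun T => T ξ) this.fderiv
  · simp [matDeriv, posMatrix, h]

theorem matDeriv_lax_diag (x ξ : (Fin n → ℝ) × (Fin n → ℝ)) (i : Fin n) :
    matDeriv (lax g) x ξ i i = ξ.2 i := by
  simp only [matDeriv, Matrix.of_apply, lax, if_true]
  have := (Complex.ofRealCLM ∘L ContinuousLinearMap.proj i ∘L
    ContinuousLinearMap.snd ℝ (Fin n → ℝ) (Fin n → ℝ)).hasFDerivAt (x := x)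
  exact congrArg (fun T => T ξ) this.fderiv

theorem matDeriv_actionMatrix (x ξ : (Fin n → ℝ) × (Fin n → ℝ)) :
    matDeriv (actionMatrix g) x ξ =
      Matrix.diagonal fun j => fderiv ℝ (fun y => (eigenvalue g j y : ℂ)) x ξ := by
  ext i j
  by_cases h : i = j
  · subst h
    simp [matDeriv, actionMatrix]
  · simp [matDeriv, actionMatrix, h]

theorem matDeriv_angleMatrix_diag (x ξ : (Fin n → ℝ) × (Fin n → ℝ)) (i : Fin n) :
    matDeriv (angleMatrix g) x ξ i i = fderiv ℝ (fun y => (angle g i y : ℂ)) x ξ := by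
  simp [matDeriv, angleMatrix, dualPosMatrix]

theorem dualFrame_relations (hg : g ≠ 0) (hx : x ∈ phaseSpace n) :
    posMatrix x * dualFrame g x = dualFrame g x * angleMatrix g x ∧
    lax g x * dualFrame g x = dualFrame g x * actionMatrix g x ∧
    dualFrame g x * onesMatrix n = onesMatrix n := by
  obtain ⟨U, hU, hW, h1, hQ, hL⟩ := exists_dualFrame_eq hg hx
  have hUU := unitary_conjTranspose_mul hU
  have hv : (fun _ => 1 : Fin n → ℂ) = 1 := rfl
  refine ⟨?_, ?_, ?_⟩
  · rw [angleMatrix, ← hQ, hW, Matrix.mul_assoc U, ← Matrix.mul_assoc Uᴴ U, hUU, Matrix.one_mul]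
  · rw [actionMatrix, ← hL, hW, Matrix.mul_assoc U, ← Matrix.mul_assoc Uᴴ U, hUU, Matrix.one_mul]
  · have h2 : Uᴴ *ᵥ 1 = 1 := by
      rw [← h1, Matrix.mulVec_mulVec, hUU, Matrix.one_mulVec, h1]
    rw [hW, onesMatrix, hv, Matrix.mul_vecMulVec, h2]

/-- The pullback of the symplectic form under the action-angle map. -/
theorem sum_angle_wedge_eigenvalue (hg : g ≠ 0) (hx : x ∈ phaseSpace n)
    (ξ η : (Fin n → ℝ) × (Fin n → ℝ)) :
    ∑ j, (fderiv ℝ (fun y => (angle g j y : ℂ)) x ξ *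
        fderiv ℝ (fun y => (eigenvalue g j y : ℂ)) x η -
      fderiv ℝ (fun y => (angle g j y : ℂ)) x η *
        fderiv ℝ (fun y => (eigenvalue g j y : ℂ)) x ξ) =
      ∑ j, ((ξ.1 j : ℂ) * η.2 j - η.1 j * ξ.2 j) := by
  obtain ⟨U, hU, hW, -⟩ := exists_dualFrame_eq hg hx
  have hUW : U * dualFrame g x = 1 := by rw [hW, unitary_mul_conjTranspose hU]
  have hWU : dualFrame g x * U = 1 := mul_eq_one_comm.mp hUW
  have hmem := (isOpen_phaseSpace n).mem_nhds hx
  obtain ⟨hQ0, hL0, -⟩ := dualFrame_relations hg hx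
  have dW := differentiableAt_dualFrame hg hx
  have dQ := differentiableAt_posMatrix x
  have dL := differentiableAt_lax (g := g) hx
  have dA := differentiableAt_actionMatrix hg hx
  have dB := differentiableAt_angleMatrix hg hx
  have hdQ : ∀ ζ, U * matDeriv posMatrix x ζ * dualFrame g x = matDeriv (angleMatrix g) x ζ +
      (U * matDeriv (dualFrame g) x ζ * angleMatrix g x -
        angleMatrix g x * (U * matDeriv (dualFrame g) x ζ)) := by
    intro ζ
    refine frame_conj_eq hUW hQ0 ?_
    rw [← matDeriv_mul dQ dW, ← matDeriv_mul dW dB]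
    refine matDeriv_congr ?_ ζ
    filter_upwards [hmem] with y hy using (dualFrame_relations hg hy).1
  have hdL : ∀ ζ, U * matDeriv (lax g) x ζ * dualFrame g x = matDeriv (actionMatrix g) x ζ +
      (U * matDeriv (dualFrame g) x ζ * actionMatrix g x -
        actionMatrix g x * (U * matDeriv (dualFrame g) x ζ)) := by
    intro ζ
    refine frame_conj_eq hUW hL0 ?_
    rw [← matDeriv_mul dL dW, ← matDeriv_mul dW dA]
    refine matDeriv_congr ?_ ζ
    filter_upwards [hmem] with y hy using (dualFrame_relations hg hy).2.1
  have hones : ∀ ζ, U * matDeriv (dualFrame g) x ζ * onesMatrix n = 0 := by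
    intro ζ
    have h1 : matDeriv (fun y => dualFrame g y * onesMatrix n) x ζ = 0 := by
      rw [← matDeriv_const (onesMatrix n) x ζ]
      refine matDeriv_congr ?_ ζ
      filter_upwards [hmem] with y hy using (dualFrame_relations hg hy).2.2
    rw [matDeriv_mul (N := fun _ => onesMatrix n) dW (fun i j => differentiableAt_const _), matDeriv_const, Matrix.mul_zero,
      add_zero] at h1
    rw [Matrix.mul_assoc, h1, Matrix.mul_zero]
  have hcomm : ∀ ζ, (matDeriv (angleMatrix g) x ζ * actionMatrix g x -
      actionMatrix g x * matDeriv (angleMatrix g) x ζ) +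
      (angleMatrix g x * matDeriv (actionMatrix g) x ζ -
        matDeriv (actionMatrix g) x ζ * angleMatrix g x) = 0 := by
    intro ζ
    have h1 : matDeriv (fun y => angleMatrix g y * actionMatrix g y -
        actionMatrix g y * angleMatrix g y) x ζ = 0 := by
      rw [← matDeriv_const (momentumValue n g) x ζ]
      refine matDeriv_congr ?_ ζ
      filter_upwards [hmem] with y hy
      exact commutator_dualPosMatrix (eigenvalue_strictAnti hg hy)
    rw [matDeriv_sub (differentiableAt_matMul dB dA) (differentiableAt_matMul dA dB),
      matDeriv_mul dB dA, matDeriv_mul dA dB] at h1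
    rw [← h1]
    abel
  have hpair : ∀ ζ ζ', (matDeriv posMatrix x ζ * matDeriv (lax g) x ζ').trace =
      ((U * matDeriv posMatrix x ζ * dualFrame g x) *
        (U * matDeriv (lax g) x ζ' * dualFrame g x)).trace := by
    intro ζ ζ'
    have : (U * matDeriv posMatrix x ζ * dualFrame g x) *
        (U * matDeriv (lax g) x ζ' * dualFrame g x) =
        U * (matDeriv posMatrix x ζ * (dualFrame g x * U) * matDeriv (lax g) x ζ' *
          dualFrame g x) := by noncomm_ring
    rw [this, hWU, Matrix.mul_one, Matrix.trace_mul_comm U, Matrix.mul_assoc, hWU, Matrix.mul_one]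
  have hmu : angleMatrix g x * actionMatrix g x - actionMatrix g x * angleMatrix g x =
      momentumValue n g := commutator_dualPosMatrix (eigenvalue_strictAnti hg hx)
  have key := trace_symplectic_identity (Z := U * matDeriv (dualFrame g) x ξ)
    (Z' := U * matDeriv (dualFrame g) x η) (hcomm ξ) (hcomm η)
  rw [← hdQ, ← hdL, ← hdQ, ← hdL, ← hpair, ← hpair, hmu,
    trace_momentumValue_mul_commutator g (hones ξ) (hones η), add_zero] at key
  -- As `dQ` is diagonal, the off-diagonal part of `dL` drops out; in `e2` the diagonal `dΛ` does
  -- the same for `dQ̃`.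
  have e1 : ∀ ζ ζ', (matDeriv posMatrix x ζ * matDeriv (lax g) x ζ').trace =
      ∑ j, (ζ.1 j : ℂ) * ζ'.2 j := by
    intro ζ ζ'
    rw [matDeriv_posMatrix, Matrix.trace]
    simp only [Matrix.diag_apply, Matrix.diagonal_mul, matDeriv_lax_diag]
  have e2 : ∀ ζ ζ', (matDeriv (angleMatrix g) x ζ * matDeriv (actionMatrix g) x ζ').trace =
      ∑ j, fderiv ℝ (fun y => (angle g j y : ℂ)) x ζ *
        fderiv ℝ (fun y => (eigenvalue g j y : ℂ)) x ζ' := by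
    intro ζ ζ'
    rw [matDeriv_actionMatrix, Matrix.trace]
    simp only [Matrix.diag_apply, Matrix.mul_diagonal, matDeriv_angleMatrix_diag]
  rw [e1, e1, e2, e2] at key
  rw [Finset.sum_sub_distrib, Finset.sum_sub_distrib, key]

theorem fderiv_theta (hg : g ≠ 0) (hx : x ∈ phaseSpace n) (k : Fin n)
    (ξ : (Fin n → ℝ) × (Fin n → ℝ)) :
    fderiv ℝ (theta g k) x ξ = fderiv ℝ (fun y => (angle g k y : ℂ)) x ξ +
      ∑ l, -(Complex.I * g) / ((eigenvalue g k x : ℂ) - eigenvalue g l x) ^ 2 *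
        (fderiv ℝ (fun y => (eigenvalue g k y : ℂ)) x ξ -
          fderiv ℝ (fun y => (eigenvalue g l y : ℂ)) x ξ) := by
  have hev : theta g k =ᶠ[nhds x] fun y => (angle g k y : ℂ) +
      ∑ l ∈ Finset.univ.erase k, Complex.I * g *
        ((eigenvalue g k y : ℂ) - eigenvalue g l y)⁻¹ := by
    filter_upwards [(isOpen_phaseSpace n).mem_nhds hx] with y hy
    rw [theta_eq_angle_add hg hy, Finset.mul_sum]
    simp only [one_div]
  have hterm : ∀ l ∈ Finset.univ.erase k, HasFDerivAt (fun y => Complex.I * g *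
        ((eigenvalue g k y : ℂ) - eigenvalue g l y)⁻¹)
      ((-(Complex.I * g) / ((eigenvalue g k x : ℂ) - eigenvalue g l x) ^ 2) •
        (fderiv ℝ (fun y => (eigenvalue g k y : ℂ)) x -
          fderiv ℝ (fun y => (eigenvalue g l y : ℂ)) x)) x := by
    intro l hl
    have hne : (eigenvalue g k x : ℂ) - eigenvalue g l x ≠ 0 := by
      rw [sub_ne_zero]
      exact_mod_cast (eigenvalue_strictAnti hg hx).injective.ne (Finset.ne_of_mem_erase hl).symm
    have h1 := (differentiableAt_eigenvalue hg hx k).hasFDerivAt.sub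
      (differentiableAt_eigenvalue hg hx l).hasFDerivAt
    have h2 := ((hasDerivAt_inv hne).comp_hasFDerivAt x h1).const_mul (Complex.I * g)
    convert! h2 using 1
    rw [smul_smul]
    congr 1
    field_simp
  have hsum := (differentiableAt_angle hg hx k).hasFDerivAt.add (HasFDerivAt.fun_sum hterm)
  rw [hev.fderiv_eq]
  refine (congrArg (fun T => T ξ) hsum.fderiv).trans ?_
  -- The full sum includes `l = k`, where the difference of derivatives is zero.
  rw [← Finset.add_sum_erase _ _ (Finset.mem_univ k)]
  simp

/-- Passing from `φ` to `θ` adds `∑ c_kl (dλ_k - dλ_l) ∧ dλ_k = -∑ c_kl dλ_l ∧ dλ_k`, which is zero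
because `c_kl = c_lk`. -/
theorem sum_theta_wedge_eigenvalue (hg : g ≠ 0) (hx : x ∈ phaseSpace n)
    (ξ η : (Fin n → ℝ) × (Fin n → ℝ)) :
    ∑ j, (fderiv ℝ (theta g j) x ξ * fderiv ℝ (fun y => (eigenvalue g j y : ℂ)) x η -
      fderiv ℝ (theta g j) x η * fderiv ℝ (fun y => (eigenvalue g j y : ℂ)) x ξ) =
      ∑ j, ((ξ.1 j : ℂ) * η.2 j - η.1 j * ξ.2 j) := by
  rw [← sum_angle_wedge_eigenvalue hg hx ξ η, ← sub_eq_zero, ← Finset.sum_sub_distrib]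
  set b : Fin n → (Fin n → ℝ) × (Fin n → ℝ) → ℂ :=
    fun l ζ => fderiv ℝ (fun y => (eigenvalue g l y : ℂ)) x ζ with hb
  set c : Fin n → Fin n → ℂ :=
    fun k l => -(Complex.I * g) / ((eigenvalue g k x : ℂ) - eigenvalue g l x) ^ 2 with hc
  have hsymm : ∀ k l, c k l = c l k := fun k l => by
    simp only [hc]
    rw [← neg_sub, neg_sq]
  have hterm : ∀ k, fderiv ℝ (theta g k) x ξ * b k η - fderiv ℝ (theta g k) x η * b k ξ -
      (fderiv ℝ (fun y => (angle g k y : ℂ)) x ξ * b k η -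
        fderiv ℝ (fun y => (angle g k y : ℂ)) x η * b k ξ) =
      ∑ l, c k l * (b l η * b k ξ) - ∑ l, c k l * (b l ξ * b k η) := by
    intro k
    have hθ : ∀ ζ, fderiv ℝ (theta g k) x ζ = fderiv ℝ (fun y => (angle g k y : ℂ)) x ζ +
        ∑ l, c k l * (b k ζ - b l ζ) := fderiv_theta hg hx k
    rw [hθ, hθ, add_mul, add_mul, add_sub_add_comm, add_sub_cancel_left, Finset.sum_mul,
      Finset.sum_mul, ← Finset.sum_sub_distrib, ← Finset.sum_sub_distrib]
    exact Finset.sum_congr rfl fun l _ => by ring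
  rw [Finset.sum_congr rfl fun k _ => hterm k, Finset.sum_sub_distrib, sub_eq_zero,
    Finset.sum_comm]
  refine Finset.sum_congr rfl fun k _ => Finset.sum_congr rfl fun l _ => ?_
  rw [hsymm, mul_comm (b k η)]

theorem poisson_angle (hg : g ≠ 0) (hx : x ∈ phaseSpace n) (j k : Fin n) :
    poisson (fun y => (angle g j y : ℂ)) (fun y => (angle g k y : ℂ)) x = 0 ∧
    poisson (fun y => (angle g j y : ℂ)) (fun y => (eigenvalue g k y : ℂ)) x =
      (if j = k then 1 else 0) :=
  have h := canonical_of_symplectic (sum_angle_wedge_eigenvalue hg hx) j k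
  ⟨h.1, h.2.1⟩

theorem poisson_theta (hg : g ≠ 0) (hx : x ∈ phaseSpace n) (j k : Fin n) :
    poisson (theta g j) (theta g k) x = 0 ∧
    poisson (theta g j) (fun y => (eigenvalue g k y : ℂ)) x = (if j = k then 1 else 0) ∧
    poisson (fun y => (eigenvalue g j y : ℂ)) (fun y => (eigenvalue g k y : ℂ)) x = 0 :=
  canonical_of_symplectic (sum_theta_wedge_eigenvalue hg hx) j k

end tangent

end CalogeroMoser

theorem mainTheorem2 (n : ℕ) (g : ℝ) (hg : g ≠ 0) :
    -- the eigenvalues are simple, so that the denominators of the `θ_k` do not vanish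
    (∀ x ∈ CalogeroMoser.phaseSpace n,
      StrictAnti (fun k : Fin n => CalogeroMoser.eigenvalue g k x) ∧
      ∀ k : Fin n, deriv (CalogeroMoser.polyA g x) (CalogeroMoser.eigenvalue g k x : ℂ) ≠ 0) ∧
    -- the functions are smooth on the phase space
    (∀ k : Fin n,
      ContDiffOn ℝ ∞ (CalogeroMoser.eigenvalue g k) (CalogeroMoser.phaseSpace n) ∧
      ContDiffOn ℝ ∞ (CalogeroMoser.theta g k) (CalogeroMoser.phaseSpace n)) ∧
    -- the canonical Poisson bracket relations of the `θ_j` and the `λ_k`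
    (∀ x ∈ CalogeroMoser.phaseSpace n, ∀ j k : Fin n,
      CalogeroMoser.poisson (CalogeroMoser.theta g j) (CalogeroMoser.theta g k) x = 0 ∧
      CalogeroMoser.poisson (CalogeroMoser.theta g j)
        (fun y => (CalogeroMoser.eigenvalue g k y : ℂ)) x = (if j = k then 1 else 0) ∧
      CalogeroMoser.poisson (fun y => (CalogeroMoser.eigenvalue g j y : ℂ))
        (fun y => (CalogeroMoser.eigenvalue g k y : ℂ)) x = 0) ∧
    -- the action-angle coordinates `(φ, λ)` exist, are unique and canonical, and give the `θ_k`
    (∃ φ : Fin n → (Fin n → ℝ) × (Fin n → ℝ) → ℝ,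
      (∀ k : Fin n, ContDiffOn ℝ ∞ (φ k) (CalogeroMoser.phaseSpace n)) ∧
      ∀ x ∈ CalogeroMoser.phaseSpace n,
        (∀ ψ ν : Fin n → ℝ, CalogeroMoser.IsActionAngle g x ψ ν ↔
          (ψ = fun k => φ k x) ∧ ν = fun k => CalogeroMoser.eigenvalue g k x) ∧
        (∀ j k : Fin n,
          CalogeroMoser.poisson (fun y => (φ j y : ℂ)) (fun y => (φ k y : ℂ)) x = 0 ∧
          CalogeroMoser.poisson (fun y => (φ j y : ℂ))
            (fun y => (CalogeroMoser.eigenvalue g k y : ℂ)) x = (if j = k then 1 else 0)) ∧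
        ∀ k : Fin n, CalogeroMoser.theta g k x =
          (φ k x : ℂ) + Complex.I * (g : ℂ) * ∑ l ∈ Finset.univ.erase k,
            1 / ((CalogeroMoser.eigenvalue g k x : ℂ) - (CalogeroMoser.eigenvalue g l x : ℂ))) := by
  refine ⟨fun x hx => ⟨CalogeroMoser.eigenvalue_strictAnti hg hx, fun k => ?_⟩,
    fun k => ⟨fun x hx => (CalogeroMoser.contDiffAt_eigenvalue hg hx k).contDiffWithinAt,
      fun x hx => (CalogeroMoser.contDiffAt_theta hg hx k).contDiffWithinAt⟩,
    fun x hx j k => CalogeroMoser.poisson_theta hg hx j k,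
    CalogeroMoser.angle g,
    fun k x hx => (CalogeroMoser.contDiffAt_angle hg hx k).contDiffWithinAt,
    fun x hx => ⟨CalogeroMoser.isActionAngle_iff hg hx,
      CalogeroMoser.poisson_angle hg hx, CalogeroMoser.theta_eq_angle_add hg hx⟩⟩
  rw [CalogeroMoser.deriv_polyA_eigenvalue]
  exact CalogeroMoser.prod_erase_sub_ne_zero
    (CalogeroMoser.eigenvalue_strictAnti hg hx).injective k
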